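/- Let $K\subset\mathbb{C}$ be a compact set with $0\notin K$. Then there exists a finite radius $r_0=r_0(K)>0$, depending only on $K$, such that for every sequence $(\phi_n)_{n\ge 0}$ with $\phi_n\in K$ for all $n$, the power series $$g(z)=\sum_{n\ge 0}\phi_n\frac{z^n}{\sqrt{n!}}$$ converges absolutely for every $z\in\mathbb{C}$, and $g$ has a zero in the closed disk $\{z\in\mathbb{C} : |z|\le r_0\}$. -/

import Mathlib

/-- The `n`-th term `φ n * z ^ n / √(n!)` of the power series with coefficient sequence `φ`. -/
noncomputable def seriesTerm (φ : ℕ → ℂ) (z : ℂ) (n : ℕ) : ℂ :=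
  φ n * (z ^ n / ((Real.sqrt (n.factorial : ℝ) : ℝ) : ℂ))

/-- The sum `g z = ∑ n, φ n * z ^ n / √(n!)` of the power series with coefficient sequence `φ`. -/
noncomputable def seriesSum (φ : ℕ → ℂ) (z : ℂ) : ℂ :=
  ∑' n : ℕ, seriesTerm φ z n

/-! Fix `φ` and suppose `g` has no zero. Since `‖g z‖ ≤ C exp(‖z‖²)`, a logarithm of `g` has real
part `O(1 + ‖z‖²)`, so by Borel–Carathéodory and Cauchy estimates it is a quadratic polynomial, and
`g' = (b + d z) g`. At the origin this becomes `√(n+2) φₙ₊₂ = b φₙ₊₁ + d √(n+1) φₙ`.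

No `φ` bounded away from zero and infinity satisfies this. Boundedness forces `‖d‖ = 1`, and a
rotation gives `d = 1`. Telescoping `√(n+1) Re(φₙ₊₁ conj φₙ)`, which is only `O(√n)`, gives `Re b =
0`. An energy identity then yields `(n+1)‖φₙ₊₁‖² + n‖φₙ‖² = Sₙ + O(√n)` with `Sₙ = ∑_{k<n} ‖φₖ‖²`.
The left side is `n (Sₙ₊₂ - Sₙ)` up to a bounded term, so `S` would grow sublinearly, contradicting
`Sₙ ≥ a² n`.

The radius is uniform because the sequences in `K` form a compact product space and, by a Hurwitz
argument, zeros persist under small perturbations of `φ`. -/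

/-! ### Three-term recurrences with bounded solutions -/

open Filter in
/-- `√(n + 1)` is eventually dominated by any positive multiple of `n`. -/
theorem eventually_mul_sqrt_succ_le {C c : ℝ} (hC : 0 ≤ C) (hc : 0 < c) :
    ∀ᶠ n : ℕ in atTop, C * √((n : ℝ) + 1) ≤ c * n := by
  have h : Tendsto (fun n : ℕ ↦ √((n : ℝ) + 1)) atTop atTop :=
    Real.tendsto_sqrt_atTop.comp (tendsto_atTop_add_const_right _ _ tendsto_natCast_atTop_atTop)
  filter_upwards [h.eventually_ge_atTop (C / c + 1)] with n hn
  have hs : √((n : ℝ) + 1) ^ 2 = n + 1 := Real.sq_sqrt (by positivity)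
  set s := √((n : ℝ) + 1)
  have h1 : 1 ≤ s := by have : 0 ≤ C / c := by positivity
                        linarith
  have h2 : C + c ≤ c * s := by
    have := mul_le_mul_of_nonneg_left hn hc.le
    rwa [mul_add, mul_div_cancel₀ _ hc.ne', mul_one] at this
  nlinarith [mul_le_mul_of_nonneg_right h2 (by linarith : 0 ≤ s)]

open Filter in
/-- A bounded positive sequence cannot expand by a factor `ρ > 1` along steps of two. -/
theorem not_expanding_of_bounded {u : ℕ → ℝ} {a B ρ : ℝ} (ha : 0 < a) (hau : ∀ n, a ≤ u n)
    (huB : ∀ n, u n ≤ B) (hρ : 1 < ρ) : ¬ ∀ᶠ n in atTop, ρ * u n ≤ u (n + 2) := by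
  intro h
  obtain ⟨N, hN⟩ := eventually_atTop.1 h
  have key : ∀ k : ℕ, ρ ^ k * a ≤ u (N + 2 * k) := by
    intro k
    induction k with
    | zero => simpa using hau N
    | succ k ih =>
      calc ρ ^ (k + 1) * a = ρ * (ρ ^ k * a) := by ring
        _ ≤ ρ * u (N + 2 * k) := by gcongr
        _ ≤ u (N + 2 * k + 2) := hN _ (by omega)
  obtain ⟨k, hk⟩ :=
    ((tendsto_pow_atTop_atTop_of_one_lt hρ).eventually_gt_atTop (B / a)).exists
  rw [div_lt_iff₀ ha] at hk
  linarith [key k, huB (N + 2 * k)]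

open Filter in
/-- A positive sequence bounded away from zero and infinity cannot contract by a factor `ρ < 1`
along steps of two. -/
theorem not_contracting_of_bounded {u : ℕ → ℝ} {a B ρ : ℝ} (ha : 0 < a) (hau : ∀ n, a ≤ u n)
    (huB : ∀ n, u n ≤ B) (hρ0 : 0 < ρ) (hρ : ρ < 1) :
    ¬ ∀ᶠ n in atTop, u (n + 2) ≤ ρ * u n := by
  intro h
  have hu : ∀ n, 0 < u n := fun n ↦ ha.trans_le (hau n)
  have hB : 0 < B := (hu 0).trans_le (huB 0)
  refine not_expanding_of_bounded (u := fun n ↦ (u n)⁻¹) (inv_pos.2 hB)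
    (fun n ↦ inv_anti₀ (hu n) (huB n)) (fun n ↦ inv_anti₀ ha (hau n)) ((one_lt_inv₀ hρ0).2 hρ) ?_
  filter_upwards [h] with n hn
  rw [← mul_inv]
  exact inv_anti₀ (hu _) hn

open Filter in
/-- In a three-term recurrence `√(n+2) φₙ₊₂ = b φₙ₊₁ + d √(n+1) φₙ` with `φ` bounded away from zero
and infinity, the coefficient `d` is unimodular. -/
theorem norm_eq_one_of_recurrence {φ : ℕ → ℂ} {a B : ℝ} (ha : 0 < a) (hφa : ∀ n, a ≤ ‖φ n‖)
    (hφB : ∀ n, ‖φ n‖ ≤ B) {b d : ℂ}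
    (hrec : ∀ n : ℕ, (√((n : ℝ) + 2) : ℂ) * φ (n + 2) =
      b * φ (n + 1) + d * (√((n : ℝ) + 1) : ℂ) * φ n) : ‖d‖ = 1 := by
  have hB : 0 ≤ B := ha.le.trans ((hφa 0).trans (hφB 0))
  -- The `b` term is bounded, hence negligible against `√(n+1)`: the ratio `‖φ (n+2)‖ / ‖φ n‖` tends
  -- to `‖d‖`.
  have hev : ∀ ε > 0, ∀ᶠ n : ℕ in atTop, ‖b‖ * B ≤ ε * √((n : ℝ) + 1) := by
    intro ε hε
    have h : Tendsto (fun n : ℕ ↦ √((n : ℝ) + 1)) atTop atTop :=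
      Real.tendsto_sqrt_atTop.comp
        (tendsto_atTop_add_const_right _ _ tendsto_natCast_atTop_atTop)
    filter_upwards [h.eventually_ge_atTop (‖b‖ * B / ε)] with n hn
    rwa [div_le_iff₀' hε] at hn
  have hmono : ∀ n : ℕ, √((n : ℝ) + 1) ≤ √((n : ℝ) + 2) := fun n ↦
    Real.sqrt_le_sqrt (by linarith)
  have hpos : ∀ n : ℕ, 0 < √((n : ℝ) + 1) := fun n ↦ Real.sqrt_pos.2 (by positivity)
  have hn1 : ∀ n : ℕ, ‖d * (√((n : ℝ) + 1) : ℂ) * φ n‖ = ‖d‖ * √((n : ℝ) + 1) * ‖φ n‖ := fun n ↦ by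
    rw [norm_mul, norm_mul, Complex.norm_real, Real.norm_of_nonneg (Real.sqrt_nonneg _)]
  have hn2 : ∀ n : ℕ, ‖(√((n : ℝ) + 2) : ℂ) * φ (n + 2)‖ = √((n : ℝ) + 2) * ‖φ (n + 2)‖ := fun n ↦ by
    rw [norm_mul, Complex.norm_real, Real.norm_of_nonneg (Real.sqrt_nonneg _)]
  have hbn : ∀ n, ‖b * φ (n + 1)‖ ≤ ‖b‖ * B := fun n ↦ by
    rw [norm_mul]; exact mul_le_mul_of_nonneg_left (hφB _) (norm_nonneg _)
  rcases lt_trichotomy ‖d‖ 1 with hd | hd | hd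
  · exfalso
    refine not_contracting_of_bounded ha hφa hφB (ρ := (1 + ‖d‖) / 2) (by positivity)
      (by linarith) ?_
    filter_upwards [hev (a * ((1 - ‖d‖) / 2)) (mul_pos ha (by linarith))] with n hn
    have h1 : √((n : ℝ) + 2) * ‖φ (n + 2)‖ ≤ ‖b‖ * B + ‖d‖ * √((n : ℝ) + 1) * ‖φ n‖ := by
      rw [← hn2, hrec, ← hn1]
      exact (norm_add_le _ _).trans (add_le_add_left (hbn n) _)
    have h2 : a * ((1 - ‖d‖) / 2) * √((n : ℝ) + 1) ≤ ‖φ n‖ * ((1 - ‖d‖) / 2) * √((n : ℝ) + 1) := by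
      have : 0 ≤ (1 - ‖d‖) / 2 := by linarith
      gcongr
      exact hφa n
    have h3 : √((n : ℝ) + 1) * ‖φ (n + 2)‖ ≤ √((n : ℝ) + 1) * ((1 + ‖d‖) / 2 * ‖φ n‖) := by
      have := mul_le_mul_of_nonneg_right (hmono n) (norm_nonneg (φ (n + 2)))
      linarith
    exact le_of_mul_le_mul_left h3 (hpos n)
  · exact hd
  · exfalso
    -- The gap between 1 and `‖d‖` is split: `μ` absorbs `√(n+2) / √(n+1)`, and half of `‖d‖ - μ`
    -- absorbs the `b` term.
    set μ := (1 + ‖d‖) / 2 with hμ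
    have hμ1 : 1 < μ := by linarith
    refine not_expanding_of_bounded ha hφa hφB (ρ := (‖d‖ + μ) / 2 / μ)
      (by rw [one_lt_div (by linarith)]; linarith) ?_
    filter_upwards [hev (a * ((‖d‖ - μ) / 2)) (mul_pos ha (by linarith)),
      (tendsto_natCast_atTop_atTop (R := ℝ)).eventually_ge_atTop (1 / (μ - 1))] with n hn hnμ
    have h1 : ‖d‖ * √((n : ℝ) + 1) * ‖φ n‖ ≤ √((n : ℝ) + 2) * ‖φ (n + 2)‖ + ‖b‖ * B := by
      rw [← hn2, hrec, ← hn1]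
      have := norm_sub_le (b * φ (n + 1) + d * (√((n : ℝ) + 1) : ℂ) * φ n) (b * φ (n + 1))
      rw [add_sub_cancel_left] at this
      exact this.trans (add_le_add_right (hbn n) _)
    have h2 : a * ((‖d‖ - μ) / 2) * √((n : ℝ) + 1) ≤ ‖φ n‖ * ((‖d‖ - μ) / 2) * √((n : ℝ) + 1) := by
      have : 0 ≤ (‖d‖ - μ) / 2 := by linarith
      gcongr
      exact hφa n
    have h3 : √((n : ℝ) + 2) ≤ μ * √((n : ℝ) + 1) := by
      rw [div_le_iff₀ (by linarith)] at hnμ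
      refine Real.sqrt_le_iff.2 ⟨by positivity, ?_⟩
      rw [mul_pow, Real.sq_sqrt (by positivity)]
      nlinarith
    have h4 : √((n : ℝ) + 1) * ((‖d‖ + μ) / 2 * ‖φ n‖) ≤ √((n : ℝ) + 1) * (μ * ‖φ (n + 2)‖) := by
      have := mul_le_mul_of_nonneg_right h3 (norm_nonneg (φ (n + 2)))
      linarith
    have h5 := le_of_mul_le_mul_left h4 (hpos n)
    rw [div_mul_eq_mul_div, div_le_iff₀ (by linarith)]
    linarith

open Filter in
/-- A sequence with `n (S (n + 2) - S n) ≤ 4/3 S n` eventually cannot grow linearly. -/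
theorem not_linear_growth {S : ℕ → ℝ} {a : ℝ} (ha : 0 < a) (hS : ∀ n : ℕ, a * n ≤ S n) :
    ¬ ∀ᶠ n : ℕ in atTop, n * (S (n + 2) - S n) ≤ 4 / 3 * S n := by
  intro h
  obtain ⟨N, hN⟩ := eventually_atTop.1 (h.and (eventually_ge_atTop 2))
  have hN1 : (2 : ℝ) ≤ N := by exact_mod_cast (hN N le_rfl).2
  have hS0 : ∀ n, 0 ≤ S n := fun n ↦ (by positivity : 0 ≤ a * n).trans (hS n)
  -- `S ^ 4 / n ^ 3` does not increase along steps of two. The hypothesis suggests growth of order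
  -- `n ^ (2/3)`; the weaker exponent `3/4` leaves room for an exact polynomial inequality.
  have step : ∀ x s t : ℝ, 2 ≤ x → 0 ≤ s → 0 ≤ t → x * (t - s) ≤ 4 / 3 * s →
      t ^ 4 * x ^ 3 ≤ s ^ 4 * (x + 2) ^ 3 := by
    intro x s t hx hs ht hst
    have h1 : x * t ≤ (x + 4 / 3) * s := by linarith
    have h2 : (x * t) ^ 4 ≤ ((x + 4 / 3) * s) ^ 4 := by gcongr
    have h3 : (x + 4 / 3) ^ 4 ≤ x * (x + 2) ^ 3 := by
      have e : x * (x + 2) ^ 3 - (x + 4 / 3) ^ 4 =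
          2 / 3 * x ^ 2 * (x - 2) + 8 / 3 * x * (x - 2) + 104 / 27 * (x - 2) + 368 / 81 := by ring
      have : 0 ≤ x * (x + 2) ^ 3 - (x + 4 / 3) ^ 4 := by
        rw [e]
        have := sub_nonneg.2 hx
        positivity
      linarith
    have h4 : x * (t ^ 4 * x ^ 3) ≤ x * (s ^ 4 * (x + 2) ^ 3) := by
      calc x * (t ^ 4 * x ^ 3) = (x * t) ^ 4 := by ring
        _ ≤ _ := h2
        _ = (x + 4 / 3) ^ 4 * s ^ 4 := by ring
        _ ≤ x * (x + 2) ^ 3 * s ^ 4 := by gcongr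
        _ = _ := by ring
    exact le_of_mul_le_mul_left h4 (by linarith)
  have key : ∀ k : ℕ, S (N + 2 * k) ^ 4 ≤ S N ^ 4 * ((N + 2 * k : ℕ) : ℝ) ^ 3 := by
    intro k
    induction k with
    | zero =>
      have : (1 : ℝ) ≤ (N : ℝ) ^ 3 := one_le_pow₀ (by linarith)
      simpa using le_mul_of_one_le_right (pow_nonneg (hS0 N) 4) this
    | succ k ih =>
      have h1 := hN (N + 2 * k) (by omega)
      have hx : (2 : ℝ) ≤ ((N + 2 * k : ℕ) : ℝ) := by exact_mod_cast h1.2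
      have h2 := step _ _ _ hx (hS0 _) (hS0 _) h1.1
      have h3 := h2.trans (mul_le_mul_of_nonneg_right ih (by positivity))
      have h4 : ((N + 2 * k : ℕ) : ℝ) ^ 3 * S (N + 2 * k + 2) ^ 4 ≤
          ((N + 2 * k : ℕ) : ℝ) ^ 3 * (S N ^ 4 * (((N + 2 * k : ℕ) : ℝ) + 2) ^ 3) := by linarith
      have h5 := le_of_mul_le_mul_left h4 (by positivity)
      have e : (((N + 2 * (k + 1) : ℕ) : ℝ)) = ((N + 2 * k : ℕ) : ℝ) + 2 := by push_cast; ring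
      rw [e]
      exact h5
  obtain ⟨k, hk⟩ := exists_nat_gt (S N ^ 4 / a ^ 4)
  have h1 := key k
  have hx : (2 : ℝ) ≤ ((N + 2 * k : ℕ) : ℝ) := by exact_mod_cast (hN (N + 2 * k) (by omega)).2
  have hkx : (k : ℝ) ≤ ((N + 2 * k : ℕ) : ℝ) := by exact_mod_cast (by omega : k ≤ N + 2 * k)
  have h2 := pow_le_pow_left₀ (by positivity) (hS (N + 2 * k)) 4
  rw [div_lt_iff₀ (by positivity)] at hk
  set x : ℝ := ((N + 2 * k : ℕ) : ℝ)
  have h3 : x ^ 3 * (a ^ 4 * x) ≤ x ^ 3 * S N ^ 4 := by nlinarith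
  have h4 := le_of_mul_le_mul_left h3 (by positivity)
  have h5 : k * a ^ 4 ≤ x * a ^ 4 := by gcongr
  linarith

open Filter in
/-- The normalised recurrence `√(n+2) φₙ₊₂ = b φₙ₊₁ + √(n+1) φₙ` has no solution bounded away from
zero and infinity. -/
theorem not_recurrence_of_bounded {φ : ℕ → ℂ} {a B : ℝ} (ha : 0 < a) (hφa : ∀ n, a ≤ ‖φ n‖)
    (hφB : ∀ n, ‖φ n‖ ≤ B) (b : ℂ) :
    ¬ ∀ n : ℕ, (√((n : ℝ) + 2) : ℂ) * φ (n + 2) =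
      b * φ (n + 1) + (√((n : ℝ) + 1) : ℂ) * φ n := by
  intro hrec
  have hB : 0 ≤ B := ha.le.trans ((hφa 0).trans (hφB 0))
  set s : ℕ → ℝ := fun n ↦ √((n : ℝ) + 1) with hs
  have hs0 : ∀ n, 0 ≤ s n := fun n ↦ Real.sqrt_nonneg _
  have hs2 : ∀ n, s n ^ 2 = n + 1 := fun n ↦ Real.sq_sqrt (by positivity)
  have hs1 : ∀ n : ℕ, √((n : ℝ) + 2) = s (n + 1) := fun n ↦ by
    simp only [hs]; congr 1; push_cast; ring
  set x : ℕ → ℝ := fun n ↦ (φ n).re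
  set y : ℕ → ℝ := fun n ↦ (φ n).im
  set p := b.re
  set q := b.im
  have hx : ∀ n, s (n + 1) * x (n + 2) = p * x (n + 1) - q * y (n + 1) + s n * x n := fun n ↦ by
    simpa [hs1, x, y, p, q, s] using congrArg Complex.re (hrec n)
  have hy : ∀ n, s (n + 1) * y (n + 2) = p * y (n + 1) + q * x (n + 1) + s n * y n := fun n ↦ by
    simpa [hs1, x, y, p, q, s] using congrArg Complex.im (hrec n)
  set A : ℕ → ℝ := fun n ↦ x n ^ 2 + y n ^ 2 with hA
  have hAn : ∀ n, A n = ‖φ n‖ ^ 2 := fun n ↦ by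
    rw [← Complex.normSq_eq_norm_sq, Complex.normSq_apply]; simp only [hA, x, y]; ring
  have hAa : ∀ n, a ^ 2 ≤ A n := fun n ↦ by
    rw [hAn]; exact pow_le_pow_left₀ ha.le (hφa n) 2
  have hxB : ∀ n, |x n| ≤ B := fun n ↦ (Complex.abs_re_le_norm _).trans (hφB n)
  have hyB : ∀ n, |y n| ≤ B := fun n ↦ (Complex.abs_im_le_norm _).trans (hφB n)
  have hmul : ∀ u v : ℝ, |u| ≤ B → |v| ≤ B → |u * v| ≤ B * B := fun u v hu hv ↦ by
    rw [abs_mul]; exact mul_le_mul hu hv (abs_nonneg _) hB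
  -- `P n` and `Q n` are the real and imaginary parts of `√(n+1) φₙ₊₁ conj φₙ`. Multiplying the
  -- recurrence by `conj φₙ₊₁` conjugates the previous product, hence the opposite signs in `hPrec`
  -- and `hQrec`.
  set P : ℕ → ℝ := fun n ↦ s n * (x (n + 1) * x n + y (n + 1) * y n) with hP
  set Q : ℕ → ℝ := fun n ↦ s n * (y (n + 1) * x n - x (n + 1) * y n) with hQ
  have hPB : ∀ n, |P n| ≤ 2 * (B * B) * s n := fun n ↦ by
    rw [hP, abs_mul, abs_of_nonneg (hs0 n), mul_comm]
    refine mul_le_mul_of_nonneg_right ((abs_add_le _ _).trans ?_) (hs0 n)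
    linarith [hmul _ _ (hxB (n + 1)) (hxB n), hmul _ _ (hyB (n + 1)) (hyB n)]
  have hQB : ∀ n, |Q n| ≤ 2 * (B * B) * s n := fun n ↦ by
    rw [hQ, abs_mul, abs_of_nonneg (hs0 n), mul_comm]
    refine mul_le_mul_of_nonneg_right ((abs_sub _ _).trans ?_) (hs0 n)
    linarith [hmul _ _ (hyB (n + 1)) (hxB n), hmul _ _ (hxB (n + 1)) (hyB n)]
  have hs_one : ∀ n, 1 ≤ s n := fun n ↦ Real.one_le_sqrt.2 (by linarith [n.cast_nonneg (α := ℝ)])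
  have hPrec : ∀ n, P (n + 1) - P n = p * A (n + 1) := fun n ↦ by
    simp only [hP, hA]; linear_combination x (n + 1) * hx n + y (n + 1) * hy n
  have hQrec : ∀ n, Q (n + 1) + Q n = q * A (n + 1) := fun n ↦ by
    simp only [hQ, hA]; linear_combination x (n + 1) * hy n - y (n + 1) * hx n
  have hp : p = 0 := by
    by_contra hp
    have hpos : 0 < |p| := abs_pos.2 hp
    have hsum : ∀ n : ℕ, |p| * a ^ 2 * n ≤ |P n - P 0| := by
      intro n
      have h1 : P n - P 0 = p * ∑ k ∈ Finset.range n, A (k + 1) := by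
        rw [← Finset.sum_range_sub, Finset.mul_sum]
        exact Finset.sum_congr rfl fun k _ ↦ hPrec k
      have h2 : (n : ℝ) * a ^ 2 ≤ ∑ k ∈ Finset.range n, A (k + 1) := by
        simpa using Finset.card_nsmul_le_sum (Finset.range n) (fun k ↦ A (k + 1)) (a ^ 2)
          fun k _ ↦ hAa _
      rw [h1, abs_mul, mul_assoc, mul_comm (a ^ 2)]
      exact mul_le_mul_of_nonneg_left (h2.trans (le_abs_self _)) hpos.le
    obtain ⟨n, hn, hn1⟩ := ((eventually_mul_sqrt_succ_le (C := 2 * (B * B) + |P 0|)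
      (c := |p| * a ^ 2 / 2) (by positivity) (by positivity)).and (eventually_ge_atTop 1)).exists
    have h1 := hsum n
    have h2 : |P n - P 0| ≤ (2 * (B * B) + |P 0|) * s n := by
      have := le_mul_of_one_le_right (abs_nonneg (P 0)) (hs_one n)
      linarith [abs_sub (P n) (P 0), hPB n]
    have h3 : 0 < |p| * a ^ 2 * n := by positivity
    change (2 * (B * B) + |P 0|) * s n ≤ |p| * a ^ 2 / 2 * n at hn
    linarith
  set T : ℕ → ℝ := fun n ↦ (n + 1) * A (n + 1) + n * A n with hT
  set S : ℕ → ℝ := fun n ↦ ∑ k ∈ Finset.range n, A k with hS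
  -- With `p = 0`, taking squared moduli in the recurrence leaves a cross term in `Q n`, which
  -- `hQrec` turns into a telescoping difference.
  have hTrec : ∀ n, T (n + 1) - T n = A n + q * (Q (n + 1) - Q n) := by
    intro n
    have h1 : (s (n + 1)) ^ 2 * A (n + 2) - (s n) ^ 2 * A n = q * (Q (n + 1) - Q n) := by
      have hx' := hx n
      have hy' := hy n
      have hQ' := hQrec n
      rw [hp] at hx' hy'
      have h2 : s (n + 1) ^ 2 * A (n + 2) =
          q ^ 2 * A (n + 1) + s n ^ 2 * A n - 2 * q * Q n := by
        have e : s (n + 1) ^ 2 * A (n + 2) =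
            (s (n + 1) * x (n + 2)) ^ 2 + (s (n + 1) * y (n + 2)) ^ 2 := by
          simp only [hA]; ring
        rw [e, hx', hy']
        simp only [hA, hQ]
        ring
      linear_combination h2 - q * hQ'
    rw [hs2, hs2] at h1
    simp only [hT]
    push_cast at h1 ⊢
    linear_combination h1
  have hTS : ∀ n, T n = T 0 + S n + q * (Q n - Q 0) := by
    intro n
    induction n with
    | zero => simp [hS]
    | succ n ih =>
      have : S (n + 1) = S n + A n := Finset.sum_range_succ _ _
      linear_combination hTrec n + ih - this
  have hSa : ∀ n : ℕ, a ^ 2 * n ≤ S n := fun n ↦ by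
    have := Finset.card_nsmul_le_sum (Finset.range n) A (a ^ 2) fun k _ ↦ hAa _
    rw [mul_comm]
    simpa using this
  refine not_linear_growth (pow_pos ha 2) hSa ?_
  -- The `O(√n)` error is at most `a ^ 2 * n / 3 ≤ S n / 3`, whence the factor `4 / 3`.
  filter_upwards [eventually_mul_sqrt_succ_le
    (C := |T 0| + |q| * |Q 0| + |q| * (2 * (B * B))) (c := a ^ 2 / 3) (by positivity)
    (by positivity)] with n hn
  change _ * s n ≤ _ at hn
  have h1 : S (n + 2) - S n = A n + A (n + 1) := by
    simp only [hS, Finset.sum_range_succ]; ring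
  have h2 : n * (S (n + 2) - S n) ≤ T n := by
    rw [h1]; simp only [hT]
    linarith [(sq_nonneg a).trans (hAa (n + 1))]
  have h3 : T 0 + q * (Q n - Q 0) ≤ (|T 0| + |q| * |Q 0| + |q| * (2 * (B * B))) * s n := by
    have e1 : T 0 ≤ |T 0| * s n :=
      (le_abs_self _).trans (le_mul_of_one_le_right (abs_nonneg _) (hs_one n))
    have e2 : q * (Q n - Q 0) ≤ |q| * |Q n| + |q| * |Q 0| := by
      rw [← mul_add]
      exact (le_abs_self _).trans ((abs_mul _ _).trans_le
        (mul_le_mul_of_nonneg_left (abs_sub _ _) (abs_nonneg _)))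
    have e3 : |q| * |Q 0| ≤ |q| * |Q 0| * s n :=
      le_mul_of_one_le_right (by positivity) (hs_one n)
    have e4 := mul_le_mul_of_nonneg_left (hQB n) (abs_nonneg q)
    linarith
  linarith [hTS n, hSa n]

/-- The recurrence `√(n+2) φₙ₊₂ = b φₙ₊₁ + d √(n+1) φₙ` has no solution bounded away from
zero and infinity. -/
theorem not_general_recurrence_of_bounded {φ : ℕ → ℂ} {a B : ℝ} (ha : 0 < a)
    (hφa : ∀ n, a ≤ ‖φ n‖) (hφB : ∀ n, ‖φ n‖ ≤ B) (b d : ℂ) :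
    ¬ ∀ n : ℕ, (√((n : ℝ) + 2) : ℂ) * φ (n + 2) =
      b * φ (n + 1) + d * (√((n : ℝ) + 1) : ℂ) * φ n := by
  intro hrec
  have hd := norm_eq_one_of_recurrence ha hφa hφB hrec
  -- Dividing `φ n` by `ω ^ n` preserves moduli and replaces `(b, d)` by `(b / ω, 1)`.
  obtain ⟨ω, hω⟩ := IsAlgClosed.exists_pow_nat_eq d two_pos
  have hωn : ‖ω‖ = 1 := by
    rw [← hω, norm_pow] at hd
    exact (pow_eq_one_iff_of_nonneg (norm_nonneg _) two_ne_zero).1 hd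
  have hω0 : ω ≠ 0 := norm_ne_zero_iff.1 (by rw [hωn]; exact one_ne_zero)
  have hn : ∀ n, ‖φ n / ω ^ n‖ = ‖φ n‖ := fun n ↦ by simp [hωn]
  refine not_recurrence_of_bounded (φ := fun n ↦ φ n / ω ^ n) ha (fun n ↦ (hφa n).trans_eq (hn n).symm)
    (fun n ↦ (hn n).trans_le (hφB n)) (b / ω) fun n ↦ ?_
  have h := hrec n
  rw [← hω] at h
  rw [← mul_div_assoc, h]
  field_simp
  ring

/-! ### Zero-free entire functions of order two -/

open Filter Topology in
/-- An entire function of quadratic growth has vanishing third derivative. -/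
theorem iteratedDeriv_three_eq_zero_of_quadratic_growth {h : ℂ → ℂ} (hh : Differentiable ℂ h)
    {L : ℝ} (hL : ∀ z, ‖h z‖ ≤ L * (1 + ‖z‖ ^ 2)) (c : ℂ) : iteratedDeriv 3 h c = 0 := by
  have hb : ∀ R : ℝ, 0 < R →
      ‖iteratedDeriv 3 h c‖ ≤ (3).factorial * (L * (1 + (‖c‖ + R) ^ 2)) / R ^ 3 := by
    intro R hR
    refine Complex.norm_iteratedDeriv_le_of_forall_mem_sphere_norm_le 3 hR hh.diffContOnCl ?_
    intro z hz
    have hL0 : 0 ≤ L := by simpa using (norm_nonneg _).trans (hL 0)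
    have hz' : ‖z‖ ≤ ‖c‖ + R := by
      have := norm_sub_norm_le z c
      rw [mem_sphere_iff_norm.1 hz] at this
      linarith
    exact (hL z).trans (by gcongr)
  have hlim : Tendsto
      (fun R : ℝ ↦ ((3).factorial * (L * (1 + (‖c‖ + R) ^ 2)) / R ^ 3 : ℝ)) atTop (𝓝 0) := by
    have h1 : Tendsto (fun R : ℝ ↦ R⁻¹) atTop (𝓝 0) := tendsto_inv_atTop_zero
    have h2 : Tendsto (fun R : ℝ ↦ ((3).factorial * L : ℝ) *
        ((R⁻¹) ^ 3 + (‖c‖ * R⁻¹ + 1) ^ 2 * R⁻¹)) atTop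
        (𝓝 0) := by
      simpa using
        ((h1.pow 3).add ((((h1.const_mul ‖c‖).add_const 1).pow 2).mul h1)).const_mul
          ((3).factorial * L : ℝ)
    refine h2.congr' ?_
    filter_upwards [eventually_gt_atTop 0] with R hR
    field_simp
  have := ge_of_tendsto hlim ((eventually_gt_atTop 0).mono hb)
  exact norm_le_zero_iff.1 this

/-- The derivative of an entire function of quadratic growth is affine. -/
theorem exists_deriv_eq_affine_of_quadratic_growth {h : ℂ → ℂ} (hh : Differentiable ℂ h)
    {L : ℝ} (hL : ∀ z, ‖h z‖ ≤ L * (1 + ‖z‖ ^ 2)) : ∃ b d : ℂ, ∀ z, deriv h z = b + d * z := by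
  have h1 : Differentiable ℂ (deriv h) := hh.deriv
  have h2 : Differentiable ℂ (deriv (deriv h)) := h1.deriv
  have h3 : ∀ z, deriv (deriv (deriv h)) z = 0 := fun z ↦ by
    have := iteratedDeriv_three_eq_zero_of_quadratic_growth hh hL z
    simpa [iteratedDeriv_succ, iteratedDeriv_zero] using this
  have h4 : ∀ z, deriv (deriv h) z = deriv (deriv h) 0 := fun z ↦
    is_const_of_deriv_eq_zero h2 h3 z 0
  have hsub : ∀ z, HasDerivAt (fun z ↦ deriv h z - deriv (deriv h) 0 * z) 0 z := fun z ↦ by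
    have := (h1 z).hasDerivAt.fun_sub ((hasDerivAt_id z).const_mul (deriv (deriv h) 0))
    simpa [h4 z] using this
  refine ⟨deriv h 0, deriv (deriv h) 0, fun z ↦ ?_⟩
  have := is_const_of_deriv_eq_zero (fun z ↦ (hsub z).differentiableAt)
    (fun z ↦ (hsub z).deriv) z 0
  simp only [mul_zero, sub_zero] at this
  linear_combination this

/-- A zero-free entire function dominated by `C exp(|z|²)` satisfies a first-order linear differential
equation with affine coefficient. -/
theorem exists_deriv_eq_affine_mul_of_zero_free {f : ℂ → ℂ} (hf : Differentiable ℂ f)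
    (hf0 : ∀ z, f z ≠ 0) {C : ℝ} (hC : ∀ z, ‖f z‖ ≤ C * Real.exp (‖z‖ ^ 2)) :
    ∃ b d : ℂ, ∀ z, deriv f z = (b + d * z) * f z := by
  have hquot : Differentiable ℂ fun z ↦ deriv f z / f z := hf.deriv.div hf hf0
  obtain ⟨h₀, hh₀⟩ := hquot.isExactOn_univ
  set h : ℂ → ℂ := fun z ↦ h₀ z - h₀ 0 with hh_def
  have hh : ∀ z, HasDerivAt h (deriv f z / f z) z := fun z ↦
    (hh₀ z (Set.mem_univ z)).sub_const _
  have hdiff : Differentiable ℂ h := fun z ↦ (hh z).differentiableAt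
  have hconst : ∀ z, f z * Complex.exp (-h z) = f 0 := by
    have hd : ∀ z, HasDerivAt (fun z ↦ f z * Complex.exp (-h z)) 0 z := fun z ↦ by
      have := (hf z).hasDerivAt.fun_mul (hh z).fun_neg.cexp
      have e : deriv f z * Complex.exp (-h z) +
          f z * (Complex.exp (-h z) * -(deriv f z / f z)) = 0 := by
        have := mul_div_cancel₀ (deriv f z) (hf0 z)
        linear_combination -Complex.exp (-h z) * this
      exact e ▸ this
    intro z
    have := is_const_of_deriv_eq_zero (fun z ↦ (hd z).differentiableAt)
      (fun z ↦ (hd z).deriv) z 0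
    simpa [hh_def] using this
  have hre : ∀ z, (h z).re ≤ |Real.log (C / ‖f 0‖)| + ‖z‖ ^ 2 := by
    intro z
    have hf0n : 0 < ‖f 0‖ := norm_pos_iff.2 (hf0 0)
    have hC0 : 0 < C := by simpa using hf0n.trans_le (hC 0)
    have e : Real.exp (h z).re * ‖f 0‖ = ‖f z‖ := by
      rw [← hconst z, norm_mul, Complex.norm_exp, Complex.neg_re, Real.exp_neg]
      have := (Real.exp_pos (h z).re).ne'
      field_simp
    have h1 : Real.exp (h z).re ≤ Real.exp (Real.log (C / ‖f 0‖) + ‖z‖ ^ 2) := by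
      rw [Real.exp_add, Real.exp_log (by positivity), div_mul_eq_mul_div, le_div_iff₀ hf0n, e]
      exact hC z
    exact (Real.exp_le_exp.1 h1).trans (add_le_add_left (le_abs_self _) _)
  set l := |Real.log (C / ‖f 0‖)|
  have hl : 0 ≤ l := abs_nonneg _
  have hgrow : ∀ z, ‖h z‖ ≤ (2 * l + 8) * (1 + ‖z‖ ^ 2) := by
    intro z
    have hR : 0 < 2 * ‖z‖ + 1 := by positivity
    -- A radius about twice `‖z‖` keeps `‖z‖ / (R - ‖z‖)` below 1; the extra 1 covers `z = 0`.
    have hbc := Complex.borelCaratheodory_zero (f := h) (z := z) (R := 2 * ‖z‖ + 1)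
      (M := l + (2 * ‖z‖ + 1) ^ 2) (by positivity) hdiff.differentiableOn
      (fun w hw ↦ by
        have hw' : ‖w‖ ≤ 2 * ‖z‖ + 1 := (mem_ball_zero_iff.1 hw).le
        exact (hre w).trans (by gcongr)) hR
      (by rw [mem_ball_zero_iff]; linarith [norm_nonneg z]) (by simp [hh_def])
    refine hbc.trans ?_
    rw [div_le_iff₀ (by linarith [norm_nonneg z])]
    have hz := norm_nonneg z
    set r := ‖z‖
    have : 0 ≤ l * r ^ 3 := by positivity
    nlinarith [mul_nonneg hl hz, mul_nonneg hl (sq_nonneg r), pow_nonneg hz 3, sq_nonneg (r - 1)]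
  obtain ⟨b, d, hbd⟩ := exists_deriv_eq_affine_of_quadratic_growth hdiff hgrow
  refine ⟨b, d, fun z ↦ ?_⟩
  rw [← hbd z, (hh z).deriv, div_mul_cancel₀ _ (hf0 z)]

/-- Iterated derivatives of a solution of `f' = (b + d z) f` satisfy a three-term recurrence. -/
theorem iteratedDeriv_add_two_of_deriv_eq_affine_mul {f : ℂ → ℂ} (hf : Differentiable ℂ f)
    {b d : ℂ} (hbd : ∀ z, deriv f z = (b + d * z) * f z) (n : ℕ) (z : ℂ) :
    iteratedDeriv (n + 2) f z =
      (b + d * z) * iteratedDeriv (n + 1) f z + (n + 1) * d * iteratedDeriv n f z := by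
  have hdiff : ∀ k, Differentiable ℂ (iteratedDeriv k f) := fun k ↦
    (hf.contDiff (n := ⊤)).differentiable_iteratedDeriv k (by exact WithTop.coe_lt_top _)
  have hl : ∀ z, HasDerivAt (fun z ↦ b + d * z) d z := fun z ↦ by
    simpa using ((hasDerivAt_id z).const_mul d).const_add b
  have hd : ∀ k z, HasDerivAt (iteratedDeriv k f) (iteratedDeriv (k + 1) f z) z := fun k z ↦ by
    rw [iteratedDeriv_succ]; exact (hdiff k z).hasDerivAt
  induction n generalizing z with
  | zero =>
    have e : iteratedDeriv 1 f = fun z ↦ (b + d * z) * iteratedDeriv 0 f z := by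
      funext z; simpa using hbd z
    rw [iteratedDeriv_succ, e, ((hl z).fun_mul (hd 0 z)).deriv]
    rw [e]
    push_cast
    ring
  | succ n ih =>
    rw [iteratedDeriv_succ, funext ih,
      (((hl z).fun_mul (hd (n + 1) z)).fun_add ((hd n z).const_mul (((n : ℂ) + 1) * d))).deriv]
    rw [show iteratedDeriv (n + 1 + 1) f z = _ from ih z]
    push_cast
    ring

/-! ### Growth and Taylor coefficients of the series -/

/-- The terms of the series are dominated by a geometric sequence. -/
theorem norm_seriesTerm_le {φ : ℕ → ℂ} {B : ℝ} (hB : ∀ n, ‖φ n‖ ≤ B) (z : ℂ) (n : ℕ) :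
    ‖seriesTerm φ z n‖ ≤ B * Real.exp (‖z‖ ^ 2) * (√2)⁻¹ ^ n := by
  have hB0 : 0 ≤ B := (norm_nonneg _).trans (hB 0)
  have h1 : ‖z‖ ^ n / √(n.factorial : ℝ) ≤ Real.exp (‖z‖ ^ 2) * (√2)⁻¹ ^ n := by
    -- Doubling `‖z‖ ^ 2` here produces, after a square root, the geometric factor `(√2)⁻¹ ^ n`.
    have h2 := Real.pow_div_factorial_le_exp (2 * ‖z‖ ^ 2) (by positivity) n
    have hs : √2 ^ 2 = (2 : ℝ) := Real.sq_sqrt (by norm_num)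
    have hf : √(n.factorial : ℝ) ^ 2 = n.factorial := Real.sq_sqrt (by positivity)
    refine le_of_sq_le_sq ?_ (by positivity)
    have e1 : (‖z‖ ^ n / √(n.factorial : ℝ)) ^ 2 =
        (2 * ‖z‖ ^ 2) ^ n / n.factorial * ((√2)⁻¹ ^ n) ^ 2 := by
      rw [div_pow, hf, ← pow_mul (√2)⁻¹, mul_comm n 2, pow_mul (√2)⁻¹, inv_pow, hs, inv_pow,
        mul_pow]
      field_simp
      ring
    have e2 : Real.exp (2 * ‖z‖ ^ 2) = Real.exp (‖z‖ ^ 2) ^ 2 := by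
      rw [← Real.exp_nat_mul]; norm_num
    rw [e1, mul_pow (Real.exp _), ← e2]
    gcongr
  calc ‖seriesTerm φ z n‖ = ‖φ n‖ * (‖z‖ ^ n / √(n.factorial : ℝ)) := by
        rw [seriesTerm, norm_mul, norm_div, norm_pow, Complex.norm_real,
          Real.norm_of_nonneg (Real.sqrt_nonneg _)]
    _ ≤ B * (Real.exp (‖z‖ ^ 2) * (√2)⁻¹ ^ n) := by
        gcongr
        exact hB n
    _ = _ := by ring

theorem summable_inv_sqrt_two_pow : Summable fun n : ℕ ↦ (√2)⁻¹ ^ n :=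
  summable_geometric_of_lt_one (by positivity)
    (inv_lt_one_of_one_lt₀ (Real.lt_sqrt_of_sq_lt (by norm_num)))

theorem summable_norm_seriesTerm {φ : ℕ → ℂ} {B : ℝ} (hB : ∀ n, ‖φ n‖ ≤ B) (z : ℂ) :
    Summable fun n ↦ ‖seriesTerm φ z n‖ :=
  (summable_inv_sqrt_two_pow.mul_left _).of_nonneg_of_le (fun _ ↦ norm_nonneg _)
    (norm_seriesTerm_le hB z)

theorem norm_seriesSum_le {φ : ℕ → ℂ} {B : ℝ} (hB : ∀ n, ‖φ n‖ ≤ B) (z : ℂ) :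
    ‖seriesSum φ z‖ ≤ B * (∑' n : ℕ, (√2)⁻¹ ^ n) * Real.exp (‖z‖ ^ 2) := by
  have := tsum_of_norm_bounded ((summable_inv_sqrt_two_pow.mul_left _).hasSum)
    (norm_seriesTerm_le hB z)
  rw [tsum_mul_left] at this
  exact this.trans_eq (by ring)

/-- `seriesSum φ` has the expected power series at the origin, with infinite radius. -/
theorem hasFPowerSeriesOnBall_seriesSum {φ : ℕ → ℂ} {B : ℝ} (hB : ∀ n, ‖φ n‖ ≤ B) :
    HasFPowerSeriesOnBall (seriesSum φ)
      (FormalMultilinearSeries.ofScalars ℂ fun n ↦ φ n / (√(n.factorial : ℝ) : ℂ)) 0 ⊤ := by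
  set c : ℕ → ℂ := fun n ↦ φ n / (√(n.factorial : ℝ) : ℂ)
  set p := FormalMultilinearSeries.ofScalars ℂ c
  have hterm : ∀ z n, c n * z ^ n = seriesTerm φ z n := fun z n ↦ by
    simp only [c, seriesTerm]; ring
  have hr : p.radius = ⊤ := by
    rw [FormalMultilinearSeries.radius_eq_top_iff_summable_norm]
    intro r
    refine (summable_norm_seriesTerm hB (r : ℂ)).congr fun n ↦ ?_
    rw [FormalMultilinearSeries.ofScalars_norm, ← hterm, norm_mul, norm_pow]
    simp
  have hsum : seriesSum φ = p.sum := by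
    funext z
    change _ = FormalMultilinearSeries.ofScalarsSum c z
    rw [FormalMultilinearSeries.ofScalars_sum_eq]
    exact tsum_congr fun n ↦ (hterm z n).symm
  rw [hsum, ← hr]
  exact p.hasFPowerSeriesOnBall (by simp [hr])

theorem differentiable_seriesSum {φ : ℕ → ℂ} {B : ℝ} (hB : ∀ n, ‖φ n‖ ≤ B) :
    Differentiable ℂ (seriesSum φ) := by
  have := (hasFPowerSeriesOnBall_seriesSum hB).differentiableOn
  rwa [Metric.eball_top, differentiableOn_univ] at this

theorem iteratedDeriv_seriesSum_zero {φ : ℕ → ℂ} {B : ℝ} (hB : ∀ n, ‖φ n‖ ≤ B) (n : ℕ) :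
    iteratedDeriv n (seriesSum φ) 0 = (√(n.factorial : ℝ) : ℂ) * φ n := by
  have h := (hasFPowerSeriesOnBall_seriesSum hB).factorial_smul 1 n
  rw [FormalMultilinearSeries.ofScalars_apply_eq, ← iteratedDeriv_eq_iteratedFDeriv] at h
  rw [← h]
  have hf : ((√(n.factorial : ℝ) : ℝ) : ℂ) * ((√(n.factorial : ℝ) : ℝ) : ℂ) = n.factorial := by
    rw [← Complex.ofReal_mul, Real.mul_self_sqrt (by positivity), Complex.ofReal_natCast]
  have hf0 : ((√(n.factorial : ℝ) : ℝ) : ℂ) ≠ 0 := by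
    rw [Complex.ofReal_ne_zero]; positivity
  rw [one_pow, smul_eq_mul, nsmul_eq_mul, mul_one, ← hf]
  field_simp

/-- The sum of the series with coefficients bounded away from zero and infinity has a zero. -/
theorem exists_seriesSum_eq_zero {φ : ℕ → ℂ} {a B : ℝ} (ha : 0 < a) (hφa : ∀ n, a ≤ ‖φ n‖)
    (hB : ∀ n, ‖φ n‖ ≤ B) : ∃ z, seriesSum φ z = 0 := by
  by_contra! h0
  have hdiff := differentiable_seriesSum hB
  obtain ⟨b, d, hbd⟩ := exists_deriv_eq_affine_mul_of_zero_free hdiff h0 (norm_seriesSum_le hB)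
  refine not_general_recurrence_of_bounded ha hφa hB b d fun n ↦ ?_
  have h := iteratedDeriv_add_two_of_deriv_eq_affine_mul hdiff hbd n 0
  simp only [iteratedDeriv_seriesSum_zero hB, mul_zero, add_zero] at h
  have e1 : √((n + 1).factorial : ℝ) = √((n : ℝ) + 1) * √(n.factorial : ℝ) := by
    rw [Nat.factorial_succ, ← Real.sqrt_mul (by positivity)]; push_cast; rfl
  have e2 : √((n + 2).factorial : ℝ) = √((n : ℝ) + 2) * (√((n : ℝ) + 1) * √(n.factorial : ℝ)) := by
    rw [← e1, Nat.factorial_succ, ← Real.sqrt_mul (by positivity)]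
    push_cast; congr 2; ring
  have e3 : ((√((n : ℝ) + 1) : ℝ) : ℂ) * ((√((n : ℝ) + 1) : ℝ) : ℂ) = n + 1 := by
    rw [← Complex.ofReal_mul, Real.mul_self_sqrt (by positivity)]; push_cast; rfl
  have h1 : ((√((n : ℝ) + 1) : ℝ) : ℂ) ≠ 0 := by
    rw [Complex.ofReal_ne_zero]; positivity
  have h2 : ((√(n.factorial : ℝ) : ℝ) : ℂ) ≠ 0 := by
    rw [Complex.ofReal_ne_zero]; positivity
  rw [e1, e2, ← e3] at h
  push_cast at h
  -- The common factor is `√((n+1)!)`; writing `n + 1` as a square leaves one `√(n+1)` on the `d`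
  -- term.
  refine mul_left_cancel₀ (mul_ne_zero h1 h2) ?_
  linear_combination h

/-! ### Persistence of zeros and compactness -/

open Metric in
/-- If `g` is smaller at the centre of a disc than on its boundary, it vanishes in the disc. -/
theorem exists_eq_zero_of_norm_center_lt {g : ℂ → ℂ} (hg : Differentiable ℂ g) {c : ℂ} {r m : ℝ}
    (hr : 0 < r) (hc : ‖g c‖ < m) (hm : ∀ z ∈ sphere c r, m ≤ ‖g z‖) :
    ∃ z ∈ closedBall c r, g z = 0 := by
  by_contra! h0
  have hm0 : 0 < m := (norm_nonneg _).trans_lt hc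
  -- Without zeros, the maximum principle applies to `1 / g`.
  have hdc : DiffContOnCl ℂ (fun z ↦ (g z)⁻¹) (ball c r) := by
    refine DifferentiableOn.diffContOnCl ?_
    rw [closure_ball _ hr.ne']
    exact hg.differentiableOn.inv h0
  have h := Complex.norm_le_of_forall_mem_frontier_norm_le isBounded_ball hdc (C := m⁻¹)
    (fun z hz ↦ by
      rw [frontier_ball _ hr.ne'] at hz
      rw [norm_inv]
      exact inv_anti₀ hm0 (hm z hz)) (subset_closure (mem_ball_self hr))
  rw [norm_inv, inv_le_inv₀ (norm_pos_iff.2 (h0 c (mem_closedBall_self hr.le))) hm0] at h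
  linarith

open Metric Filter Topology in
/-- Around every point there is a small circle on which a nonzero entire function has no zeros. -/
theorem exists_sphere_norm_ge {g : ℂ → ℂ} (hg : Differentiable ℂ g) (h0 : g 0 ≠ 0) (c : ℂ) :
    ∃ r m : ℝ, 0 < r ∧ r ≤ 1 ∧ 0 < m ∧ ∀ z ∈ sphere c r, m ≤ ‖g z‖ := by
  have han : AnalyticOnNhd ℂ g Set.univ := fun z _ ↦ hg.analyticAt z
  have hne : ∀ᶠ z in 𝓝[≠] c, g z ≠ 0 := by
    refine (han c trivial).eventually_eq_zero_or_eventually_ne_zero.resolve_left fun h ↦ h0 ?_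
    exact han.eqOn_zero_of_preconnected_of_eventuallyEq_zero isPreconnected_univ trivial h
      (Set.mem_univ 0)
  rw [eventually_nhdsWithin_iff, Metric.eventually_nhds_iff] at hne
  obtain ⟨ε, hε, h⟩ := hne
  set r := min (ε / 2) 1
  have hr : 0 < r := by positivity
  have hrε : r < ε := (min_le_left _ _).trans_lt (by linarith)
  obtain ⟨w, hw, hmin⟩ := (isCompact_sphere c r).exists_isMinOn
    (NormedSpace.sphere_nonempty.2 hr.le) hg.continuous.norm.continuousOn
  refine ⟨r, ‖g w‖, hr, min_le_right _ _, norm_pos_iff.2 (h ?_ (ne_of_mem_sphere hw hr.ne')),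
    fun z hz ↦ hmin hz⟩
  rwa [mem_sphere.1 hw]

open Metric Filter Topology in
/-- On sequences in a bounded set, `φ ↦ seriesSum φ` is continuous for locally uniform
convergence. -/
theorem eventually_norm_seriesSum_sub_lt {K : Set ℂ} {B : ℝ} (hB : ∀ w ∈ K, ‖w‖ ≤ B)
    {φ : ℕ → ℂ} (hφ : ∀ n, φ n ∈ K) (R : ℝ) {ε : ℝ} (hε : 0 < ε) :
    ∀ᶠ ψ in 𝓝[Set.univ.pi fun _ ↦ K] φ, ∀ z : ℂ, ‖z‖ ≤ R →
      ‖seriesSum ψ z - seriesSum φ z‖ < ε := by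
  set Φ : Set (ℕ → ℂ) := Set.univ.pi fun _ ↦ K
  have hsub : ∀ ψ ∈ Φ, ∀ n, ‖ψ n - φ n‖ ≤ B + B := fun ψ hψ n ↦
    (norm_sub_le _ _).trans (add_le_add (hB _ (hψ n trivial)) (hB _ (hφ n)))
  -- `F ψ` dominates the difference on the whole disc of radius `R`, and is continuous in the
  -- product topology by the Weierstrass M-test.
  set F : (ℕ → ℂ) → ℝ := fun ψ ↦ ∑' n, ‖seriesTerm (fun n ↦ ψ n - φ n) (R : ℂ) n‖
  have hF : ContinuousOn F Φ := by
    refine continuousOn_tsum (fun n ↦ ?_)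
      (summable_inv_sqrt_two_pow.mul_left ((B + B) * Real.exp (‖(R : ℂ)‖ ^ 2))) fun n ψ hψ ↦ ?_
    · unfold seriesTerm
      fun_prop
    · rw [norm_norm]
      exact norm_seriesTerm_le (hsub ψ hψ) _ n
  have hF0 : F φ = 0 := by simp [F, seriesTerm]
  have hev : ∀ᶠ ψ in 𝓝[Φ] φ, F ψ < ε :=
    (hF φ fun n _ ↦ hφ n).eventually_lt continuousWithinAt_const (by rwa [hF0])
  filter_upwards [hev, self_mem_nhdsWithin] with ψ hψ hψΦ z hz
  have e : seriesSum ψ z - seriesSum φ z = ∑' n, seriesTerm (fun n ↦ ψ n - φ n) z n := by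
    rw [seriesSum, seriesSum, ← Summable.tsum_sub
      (summable_norm_seriesTerm (fun n ↦ hB _ (hψΦ n trivial)) z).of_norm
      (summable_norm_seriesTerm (fun n ↦ hB _ (hφ n)) z).of_norm]
    exact tsum_congr fun n ↦ by simp only [seriesTerm]; ring
  rw [e]
  refine lt_of_le_of_lt ?_ hψ
  refine tsum_of_norm_bounded (summable_norm_seriesTerm (hsub ψ hψΦ) (R : ℂ)).hasSum fun n ↦ ?_
  have hR : ‖z‖ ≤ ‖(R : ℂ)‖ := by
    rw [Complex.norm_real]; exact hz.trans (le_abs_self _)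
  simp only [seriesTerm, norm_mul, norm_div, norm_pow]
  gcongr

open Metric Filter Topology in
theorem mainTheorem8 (K : Set ℂ) (hK : IsCompact K) (h0 : (0 : ℂ) ∉ K) :
    ∃ r₀ : ℝ, 0 < r₀ ∧ ∀ φ : ℕ → ℂ, (∀ n, φ n ∈ K) →
      (∀ z : ℂ, Summable (seriesTerm φ z)) ∧ ∃ z : ℂ, ‖z‖ ≤ r₀ ∧ seriesSum φ z = 0 := by
  obtain ⟨B, hB⟩ := hK.isBounded.exists_norm_le
  obtain ⟨a, ha, hKa⟩ : ∃ a : ℝ, 0 < a ∧ ∀ w ∈ K, a ≤ ‖w‖ := by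
    obtain ⟨a, ha, h⟩ := Metric.isOpen_iff.1 hK.isClosed.isOpen_compl 0 h0
    refine ⟨a, ha, fun w hw ↦ not_lt.1 fun hlt ↦ h (mem_ball_zero_iff.2 hlt) hw⟩
  have key : ∃ r₀ : ℝ, 0 < r₀ ∧ ∀ φ ∈ Set.univ.pi fun _ : ℕ ↦ K,
      ∃ z : ℂ, ‖z‖ ≤ r₀ ∧ seriesSum φ z = 0 := by
    refine (isCompact_univ_pi fun _ : ℕ ↦ hK).induction_on
      (p := fun S ↦ ∃ r₀ : ℝ, 0 < r₀ ∧ ∀ φ ∈ S, ∃ z : ℂ, ‖z‖ ≤ r₀ ∧ seriesSum φ z = 0)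
      ⟨1, one_pos, fun _ h ↦ h.elim⟩ ?_ ?_ ?_
    · rintro S T hST ⟨r, hr, h⟩
      exact ⟨r, hr, fun φ hφ ↦ h φ (hST hφ)⟩
    · rintro S T ⟨r, hr, h⟩ ⟨r', -, h'⟩
      refine ⟨max r r', lt_max_of_lt_left hr, fun φ hφ ↦ ?_⟩
      rcases hφ with hφ | hφ
      · obtain ⟨z, hz, hz0⟩ := h φ hφ
        exact ⟨z, hz.trans (le_max_left _ _), hz0⟩
      · obtain ⟨z, hz, hz0⟩ := h' φ hφ
        exact ⟨z, hz.trans (le_max_right _ _), hz0⟩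
    · intro φ hφ
      have hφK : ∀ n, φ n ∈ K := fun n ↦ hφ n trivial
      obtain ⟨c, hc⟩ := exists_seriesSum_eq_zero ha (fun n ↦ hKa _ (hφK n)) fun n ↦ hB _ (hφK n)
      have hg0 : seriesSum φ 0 ≠ 0 := by
        have := iteratedDeriv_seriesSum_zero (fun n ↦ hB _ (hφK n)) 0
        rw [iteratedDeriv_zero] at this
        rw [this]
        simpa using ne_of_mem_of_not_mem (hφK 0) h0
      obtain ⟨r, m, hr, hr1, hm, hrm⟩ :=
        exists_sphere_norm_ge (differentiable_seriesSum fun n ↦ hB _ (hφK n)) hg0 c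
      -- Within `m / 2` of `seriesSum φ`, `seriesSum ψ` is below `m / 2` at the zero `c` and at
      -- least `m / 2` on the circle.
      refine ⟨_, Filter.inter_mem (eventually_norm_seriesSum_sub_lt hB hφK (‖c‖ + 1) (half_pos hm))
        self_mem_nhdsWithin, ‖c‖ + 1, by positivity, ?_⟩
      rintro ψ ⟨hψ, hψΦ⟩
      have hball : ∀ z ∈ closedBall c r, ‖z‖ ≤ ‖c‖ + 1 := fun z hz ↦ by
        have := norm_sub_norm_le z c
        rw [mem_closedBall_iff_norm] at hz
        linarith
      obtain ⟨z, hz, hz0⟩ := exists_eq_zero_of_norm_center_lt (m := m / 2)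
        (differentiable_seriesSum fun n ↦ hB _ (hψΦ n trivial)) hr
        (by simpa [hc] using hψ c (by linarith [norm_nonneg c]))
        (fun z hz ↦ by
          have h1 := hψ z (hball z (sphere_subset_closedBall hz))
          have h2 := norm_sub_norm_le (seriesSum φ z) (seriesSum ψ z)
          rw [norm_sub_rev] at h2
          linarith [hrm z hz])
      exact ⟨z, hball z hz, hz0⟩
  obtain ⟨r₀, hr₀, h⟩ := key
  exact ⟨r₀, hr₀, fun φ hφ ↦
    ⟨fun z ↦ (summable_norm_seriesTerm (fun n ↦ hB _ (hφ n)) z).of_norm, h φ fun n _ ↦ hφ n⟩⟩
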